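/- Let $d\ge 1$, let $W\subset\mathbb R^d$ be a measurable set with finite positive volume $v$, and let $1\le N\le n$ be integers. Write $\mu_k$ for Lebesgue measure on $k$-tuples of points of $W$. Let $\Phi_a,\Phi_b$ be real functions of $N$ points, symmetric in their arguments and integrable over $W^N$, with $S_a=\int\Phi_a\,d\mu_N\neq 0$ and $S_b=\int\Phi_b\,d\mu_N\ne 0$, and suppose that for $0\le k\le N$ the integral $$S_k=\int \Phi_a(x_1,\dots,x_k,y_{k+1},\dots,y_N)\,\Phi_b(x_1,\dots,x_k,z_{k+1},\dots,z_N)\,d\mu_{2N-k}$$ converges absolutely. For finite sets $D,R$ of points and $0\le i\le N$ put $$D^iR^{N-i}[\Phi]=\sum \Phi(x_1,\dots,x_i,y_1,\dots,y_{N-i}),$$ the sum being over all pairwise distinct $x_1,\dots,x_i\in D$ and pairwise distinct $y_1,\dots,y_{N-i}\in R$. Let $D$ be a binomial point process in $W$ with $n$ points (independent and uniformly distributed in $W$), let $R$ be a binomial point process in $W$ with $n_r\ge N$ points, independent of $D$, and for $c\in\{a,b\}$ let $$\hat w_{c}=\frac1{S_c}\sum_{i=0}^N\binom Ni(-1)^{N-i}\,\frac{v^i}{(n)_i}\,\frac{v^{N-i}}{(n_r)_{N-i}}\,D^iR^{N-i}[\Phi_c],$$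 where $(n)_i=n(n-1)\cdots(n-i+1)$. Then $\hat w_a$, $\hat w_b$ and $\hat w_a\hat w_b$ are integrable, and $$\lim_{n_r\to\infty}\operatorname{Cov}(\hat w_a,\hat w_b)=\frac1{S_aS_b}\binom nN^{-1}\sum_{i=0}^N S_i\,v^i\binom Ni(-1)^{N-i}.$$ In particular, for $\Phi_a=\Phi_b$ (with $S=S_a=S_b$) this is the limit of the variance, with prefactor $1/S^2$. -/

import Mathlib

open MeasureTheory ProbabilityTheory Filter Topology

noncomputable section

/-- The `N`-tuple whose first `k` entries are `x` and whose last `N - k` entries are `y`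
(used for `k ≤ N`). -/
def joinPts {E : Type*} {N k : ℕ} (x : Fin k → E) (y : Fin (N - k) → E) : Fin N → E :=
  fun j => if h : (j : ℕ) < k then x ⟨j, h⟩ else y ⟨(j : ℕ) - k, by omega⟩

/-- A function of `N` points that is symmetric in its arguments. -/
def IsSymmFun {E : Type*} {N : ℕ} (Φ : (Fin N → E) → ℝ) : Prop :=
  ∀ (σ : Equiv.Perm (Fin N)) (x : Fin N → E), Φ (x ∘ σ) = Φ x

/-- The Lebesgue measure `μ_k` on `k`-tuples of points of the domain `W`. -/
def domMeasure {d : ℕ} (W : Set (EuclideanSpace ℝ (Fin d))) (k : ℕ) :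
    Measure (Fin k → EuclideanSpace ℝ (Fin d)) :=
  Measure.pi fun _ => volume.restrict W

/-- `S = ∫ Φ dμ_N`. -/
def phaseTotal {d N : ℕ} (W : Set (EuclideanSpace ℝ (Fin d)))
    (Φ : (Fin N → EuclideanSpace ℝ (Fin d)) → ℝ) : ℝ :=
  ∫ x, Φ x ∂(domMeasure W N)

/-- The measure `μ_{2N-k}`, the `2N - k` points being written as `(x, y, z)`, with `k` points `x`
and `N - k` points in each of `y` and `z`. -/
def sharedMeasure {d : ℕ} (W : Set (EuclideanSpace ℝ (Fin d))) (N k : ℕ) :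
    Measure ((Fin k → EuclideanSpace ℝ (Fin d)) ×
      (Fin (N - k) → EuclideanSpace ℝ (Fin d)) × (Fin (N - k) → EuclideanSpace ℝ (Fin d))) :=
  (domMeasure W k).prod ((domMeasure W (N - k)).prod (domMeasure W (N - k)))

/-- `Φ_a(x_1, …, x_k, y_{k+1}, …, y_N) Φ_b(x_1, …, x_k, z_{k+1}, …, z_N)`. -/
def sharedProduct {d N : ℕ} (Φa Φb : (Fin N → EuclideanSpace ℝ (Fin d)) → ℝ) (k : ℕ) :
    (Fin k → EuclideanSpace ℝ (Fin d)) ×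
      (Fin (N - k) → EuclideanSpace ℝ (Fin d)) × (Fin (N - k) → EuclideanSpace ℝ (Fin d)) → ℝ :=
  fun p => Φa (joinPts p.1 p.2.1) * Φb (joinPts p.1 p.2.2)

/-- `S_k = ∫ Φ_a(x_1, …, x_k, y_{k+1}, …, y_N) Φ_b(x_1, …, x_k, z_{k+1}, …, z_N) dμ_{2N-k}`. -/
def phaseShared {d N : ℕ} (W : Set (EuclideanSpace ℝ (Fin d)))
    (Φa Φb : (Fin N → EuclideanSpace ℝ (Fin d)) → ℝ) (k : ℕ) : ℝ :=
  ∫ p, sharedProduct Φa Φb k p ∂(sharedMeasure W N k)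

/-- `D^p R^{N-p}`: the sum of `Φ(x_1, …, x_p, y_1, …, y_{N-p})` over pairwise distinct
`x_1, …, x_p ∈ D` and pairwise distinct `y_1, …, y_{N-p} ∈ R`. -/
def tupleSum {E : Type*} {N : ℕ} (Φ : (Fin N → E) → ℝ) (p : ℕ) (D R : Finset E) : ℝ :=
  ∑ x : Fin p ↪ D, ∑ y : Fin (N - p) ↪ R, Φ (joinPts (fun j => (x j : E)) (fun j => (y j : E)))

/-- The edge-corrected estimator for a catalog `D` of `n` points and an auxiliary catalog `R` of
`m` points in the domain `W` of volume `v`: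
`(1/S) ∑_i (N choose i) (-1)^(N-i) (D v)^i / (n)_i * (R v)^(N-i) / (m)_(N-i)`. -/
def edgeEstimator {d N : ℕ} (W : Set (EuclideanSpace ℝ (Fin d)))
    (Φ : (Fin N → EuclideanSpace ℝ (Fin d)) → ℝ) (n m : ℕ)
    (D R : Finset (EuclideanSpace ℝ (Fin d))) : ℝ :=
  1 / phaseTotal W Φ * ∑ i ∈ Finset.range (N + 1),
    (N.choose i : ℝ) * (-1) ^ (N - i) *
      (volume.real W ^ i / (n.descFactorial i : ℝ)) *
      (volume.real W ^ (N - i) / (m.descFactorial (N - i) : ℝ)) * tupleSum Φ i D R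

open Classical in
/-- The set of points of a finite family of random points, in the outcome `ω`. -/
def catalog {Ω E ι : Type*} [Fintype ι] (X : ι → Ω → E) (ω : Ω) : Finset E :=
  Finset.univ.image fun i => X i ω

/-- The random points `X_1, …, X_n` and `Y_1, …, Y_m` are independent and uniformly distributed in
`W`: the catalogs of `X` and `Y` are independent binomial point processes in `W` with `n` and `m`
points. -/
structure AreBinomialProcesses {Ω : Type*} [MeasurableSpace Ω] {d n m : ℕ} (P : Measure Ω)
    (W : Set (EuclideanSpace ℝ (Fin d)))
    (X : Fin n → Ω → EuclideanSpace ℝ (Fin d)) (Y : Fin m → Ω → EuclideanSpace ℝ (Fin d)) :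
    Prop where
  indep : iIndepFun (Sum.elim X Y) P
  uniform_left : ∀ i, pdf.IsUniform (X i) W P volume
  uniform_right : ∀ j, pdf.IsUniform (Y j) W P volume

end

/-! The binomial sum is an inclusion-exclusion over the set `A` of argument positions filled by data
points. An average over injections of `A` equals the average of the same quantity over injections of
all `N` positions, so the normalizations depending on `i` become uniform. Almost surely the
estimator is then a constant times a sum of `(-1)^|A| Φ` over triples `(A, f, g)`, with `f`, `g`
injections of all positions into the data and random indices (`edgeEstimator_eq_sum_mixedIndex`).

All these terms have the same mean, so the signs cancel and the estimator is centred; the covariance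
is the mean of the product. By symmetry of `Φa`, `Φb`, the mean of a product of two terms depends
only on the number `k` of shared indices and equals `v^k S_k / v^(2N)`
(`integrable_mul_comp_and_integral_eq`). As the random catalog grows, two injections into it have
disjoint ranges with probability tending to one (`tendsto_average_overlap`), so only the data
overlap `|f(A) ∩ f'(B)|` survives. The signed sum over `A`, `B` then vanishes unless `f` and `f'`
have the same range (`sum_neg_one_pow_card_inter`), and counting those pairs gives the inverse
binomial coefficient. -/

/-! ### Signed sums over subsets -/

/-- Toggling membership of `b` is a fixed-point-free involution that flips the sign and preserves
`F`. -/
theorem sum_neg_one_pow_card_mul_eq_zero {α : Type*} [Fintype α] [DecidableEq α]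
    (F : Finset α → ℝ) (b : α) (h : ∀ B, b ∉ B → F (insert b B) = F B) :
    ∑ B : Finset α, (-1) ^ B.card * F B = 0 := by
  refine Finset.sum_ninvolution (fun B => if b ∈ B then B.erase b else insert b B)
    (fun B => ?_) (fun B _ => ?_) (fun _ => Finset.mem_univ _) (fun B => ?_)
  · by_cases hb : b ∈ B
    · obtain ⟨C, hC, rfl⟩ : ∃ C, b ∉ C ∧ insert b C = B :=
        ⟨B.erase b, Finset.notMem_erase _ _, Finset.insert_erase hb⟩
      simp only [Finset.mem_insert_self, if_true, Finset.erase_insert hC, h C hC,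
        Finset.card_insert_of_notMem hC]
      ring
    · simp only [hb, if_false, h B hb, Finset.card_insert_of_notMem hb]
      ring
  · by_cases hb : b ∈ B
    · simp [hb]
    · simp [hb]
  · by_cases hb : b ∈ B
    · simp [hb, Finset.insert_erase]
    · simp [hb]

/-- If some `f' b` lies outside `f(A)`, toggling `b` in `B` leaves the overlap unchanged and the
`B`-sum cancels. Otherwise the range of `f'` lies in `f(A)`, and counting forces `A` to be
everything and the ranges to agree; the overlap is then `|B|`. -/
theorem sum_neg_one_pow_card_inter {α γ : Type*} [Fintype α] [DecidableEq α] [DecidableEq γ]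
    (f f' : α ↪ γ) (c : ℕ → ℝ) :
    ∑ A : Finset α, ∑ B : Finset α,
        (-1) ^ A.card * ((-1) ^ B.card * c (A.map f ∩ B.map f').card) =
      if Finset.univ.map f' = Finset.univ.map f then
        (-1) ^ Fintype.card α *
          ∑ i ∈ Finset.range (Fintype.card α + 1), (Fintype.card α).choose i * (-1) ^ i * c i
      else 0 := by
  have key : ∀ A : Finset α, (∃ b, f' b ∉ A.map f) →
      ∑ B : Finset α, (-1) ^ A.card * ((-1) ^ B.card * c (A.map f ∩ B.map f').card) = 0 := by
    rintro A ⟨b, hb⟩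
    rw [← Finset.mul_sum, sum_neg_one_pow_card_mul_eq_zero _ b, mul_zero]
    intro B _
    rw [Finset.map_insert, Finset.inter_insert_of_notMem hb]
  have sub : ∀ A : Finset α, (¬ ∃ b, f' b ∉ A.map f) → Finset.univ.map f' = A.map f ∧
      A = Finset.univ := by
    intro A hA
    push Not at hA
    have h1 : Finset.univ.map f' ⊆ A.map f := by
      intro x hx
      obtain ⟨b, -, rfl⟩ := Finset.mem_map.1 hx
      exact hA b
    have h2 := Finset.card_le_card h1
    simp only [Finset.card_map, Finset.card_univ] at h2
    have h3 : A = Finset.univ := (Finset.card_eq_iff_eq_univ A).1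
      (le_antisymm (Finset.card_le_univ A) h2)
    exact ⟨Finset.eq_of_subset_of_card_le h1 (by simpa using Finset.card_le_univ A), h3⟩
  split_ifs with h
  · rw [Finset.sum_eq_single Finset.univ]
    · have h1 : ∀ B : Finset α, (Finset.univ.map f ∩ B.map f').card = B.card := by
        intro B
        rw [← h, ← Finset.map_inter]
        simp
      simp only [h1]
      rw [← Finset.mul_sum, Finset.card_univ, ← Finset.powerset_univ,
        Finset.sum_powerset_apply_card (fun k => (-1 : ℝ) ^ k * c k), Finset.card_univ]
      simp only [nsmul_eq_mul, mul_assoc]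
    · intro A _ hA
      exact key A (by_contra fun h' => hA (sub A h').2)
    · simp
  · refine Finset.sum_eq_zero fun A _ => key A (by_contra fun h' => h ?_)
    obtain ⟨h1, h2⟩ := sub A h'
    rw [h1, h2]

/-- The embeddings with the range of `f` are exactly `f ∘ σ` for permutations `σ`. -/
theorem card_filter_map_univ_eq {α γ : Type*} [Fintype α] [DecidableEq α] [Fintype γ]
    [DecidableEq γ] (f : α ↪ γ) :
    (Finset.univ.filter fun f' : α ↪ γ => Finset.univ.map f' = Finset.univ.map f).card =
      (Fintype.card α).factorial := by
  rw [← Fintype.card_perm, ← Finset.card_univ]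
  symm
  refine Finset.card_bij (fun σ _ => σ.toEmbedding.trans f) (fun σ _ => ?_) (fun σ _ τ _ h => ?_)
    (fun f' h => ?_)
  · simp [← Finset.map_map]
  · ext a
    exact f.injective (DFunLike.congr_fun h a)
  · have h := (Finset.mem_filter.1 h).2
    have h1 : ∀ a, ∃ b, f b = f' a := by
      intro a
      have : f' a ∈ Finset.univ.map f := by rw [← h]; simp
      simpa using this
    choose s hs using h1
    have inj : Function.Injective s := fun a b hab =>
      f'.injective (by rw [← hs a, ← hs b, hab])
    exact ⟨Equiv.ofBijective s (Finite.injective_iff_bijective.1 inj), Finset.mem_univ _, by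
      ext a; simp [hs]⟩

/-! ### Averages over injections -/

theorem sum_embedding_comp_inl {α β γ : Type*} [Fintype α] [Fintype β] [Fintype γ]
    [DecidableEq α] [DecidableEq β] [DecidableEq γ] (F : (α → γ) → ℝ) :
    ∑ f : α ⊕ β ↪ γ, F (fun a => f (Sum.inl a)) =
      (Fintype.card γ - Fintype.card α).descFactorial (Fintype.card β) * ∑ h : α ↪ γ, F h := by
  classical
  rw [← Equiv.sum_comp Equiv.sumEmbeddingEquivSigmaEmbeddingRestricted.symm, Fintype.sum_sigma,
    Finset.mul_sum]
  refine Finset.sum_congr rfl fun h _ => ?_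
  have h1 : ∀ y : β ↪ ↑(Set.range h)ᶜ,
      (fun a => Equiv.sumEmbeddingEquivSigmaEmbeddingRestricted.symm ⟨h, y⟩ (Sum.inl a)) = h := by
    intro y; rfl
  simp only [h1, Finset.sum_const, nsmul_eq_mul, Finset.card_univ]
  rw [Fintype.card_embedding_eq, Fintype.card_compl_set, Set.card_range_of_injective h.injective]

/-- Every injection of `α` has the same number of extensions to `ι`, so restriction preserves
averages. This trades the normalization `(n)_i` for `(n)_N`. -/
theorem sum_embedding_restrict_div {ι α β γ : Type*} [Fintype ι] [Fintype α] [Fintype β]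
    [Fintype γ] [DecidableEq ι] [DecidableEq α] [DecidableEq β] [DecidableEq γ]
    (e : ι ≃ α ⊕ β) (hc : Fintype.card ι ≤ Fintype.card γ) (F : (α → γ) → ℝ) :
    (∑ f : ι ↪ γ, F (fun a => f (e.symm (Sum.inl a)))) /
        (Fintype.card γ).descFactorial (Fintype.card ι) =
      (∑ h : α ↪ γ, F h) / (Fintype.card γ).descFactorial (Fintype.card α) := by
  have h1 : ∑ f : ι ↪ γ, F (fun a => f (e.symm (Sum.inl a))) =
      ∑ f : α ⊕ β ↪ γ, F (fun a => f (Sum.inl a)) := by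
    rw [← Equiv.sum_comp (Equiv.embeddingCongr e (Equiv.refl γ))]
    rfl
  have hcard : Fintype.card ι = Fintype.card α + Fintype.card β := by
    rw [Fintype.card_congr e, Fintype.card_sum]
  have h2 : (Fintype.card γ).descFactorial (Fintype.card ι) =
      (Fintype.card γ).descFactorial (Fintype.card α) *
        (Fintype.card γ - Fintype.card α).descFactorial (Fintype.card β) := by
    rw [hcard, mul_comm]
    simpa using (Nat.descFactorial_mul_descFactorial (n := Fintype.card γ)
      (Nat.le_add_right (Fintype.card α) (Fintype.card β))).symm
  have h3 : (Fintype.card γ).descFactorial (Fintype.card ι) ≠ 0 := by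
    rw [Ne, Nat.descFactorial_eq_zero_iff_lt]; omega
  rw [h2] at h3
  rw [h1, sum_embedding_comp_inl, h2]
  push_cast
  have h4 := (mul_ne_zero_iff.1 h3)
  have h5 : ((Fintype.card γ).descFactorial (Fintype.card α) : ℝ) ≠ 0 := by exact_mod_cast h4.1
  have h6 : ((Fintype.card γ - Fintype.card α).descFactorial (Fintype.card β) : ℝ) ≠ 0 := by
    exact_mod_cast h4.2
  field_simp

/-- The ratio is the probability that two independent uniform injections of `N` positions have
disjoint ranges. -/
theorem tendsto_descFactorial_div_sq (N : ℕ) :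
    Tendsto (fun m : ℕ => (m.descFactorial (N + N) : ℝ) / (m.descFactorial N : ℝ) ^ 2) atTop
      (𝓝 1) := by
  have h1 := isEquivalent_descFactorial (N + N)
  have h2 := isEquivalent_descFactorial N
  have h3 := h1.div (h2.mul h2)
  have h4 : Tendsto (fun m : ℕ => ((m : ℝ) ^ (N + N)) / ((m : ℝ) ^ N * (m : ℝ) ^ N)) atTop
      (𝓝 1) := by
    refine tendsto_const_nhds.congr' ?_
    filter_upwards [eventually_gt_atTop 0] with m hm
    have : (m : ℝ) ≠ 0 := by positivity
    rw [← pow_add, div_self (pow_ne_zero _ this)]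
  refine (h3.symm.tendsto_nhds h4).congr fun m => ?_
  simp [sq]

theorem card_filter_disjoint_range {α γ : Type*} [Fintype α] [DecidableEq α] [Fintype γ]
    [DecidableEq γ] :
    (Finset.univ.filter fun p : (α ↪ γ) × (α ↪ γ) =>
        Disjoint (Finset.univ.map p.1) (Finset.univ.map p.2)).card =
      (Fintype.card γ).descFactorial (Fintype.card α + Fintype.card α) := by
  classical
  rw [← Fintype.card_sum, ← Fintype.card_embedding_eq,
    Fintype.card_congr Equiv.sumEmbeddingEquivProdEmbeddingDisjoint, Fintype.card_subtype]
  congr 1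
  ext p
  simp [← Finset.disjoint_coe]

/-- A term deviates from `h 0` only when the ranges meet, by a bounded amount, and such pairs form a
vanishing fraction. -/
theorem tendsto_average_overlap {N : ℕ} (h : ℕ → ℝ) (A B : Finset (Fin N)) :
    Tendsto (fun m : ℕ => (∑ p : (Fin N ↪ Fin m) × (Fin N ↪ Fin m),
      h (A.map p.1 ∩ B.map p.2).card) / (m.descFactorial N : ℝ) ^ 2) atTop (𝓝 (h 0)) := by
  set C : ℝ := ∑ k ∈ Finset.range (N + 1), |h k - h 0| with hC
  rw [tendsto_iff_norm_sub_tendsto_zero]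
  have hlim : Tendsto (fun m : ℕ => C * (1 - (m.descFactorial (N + N) : ℝ) /
      (m.descFactorial N : ℝ) ^ 2)) atTop (𝓝 0) := by
    simpa using ((tendsto_const_nhds (x := (1 : ℝ))).sub
      (tendsto_descFactorial_div_sq N)).const_mul C
  refine squeeze_zero' (Eventually.of_forall fun _ => norm_nonneg _) ?_ hlim
  filter_upwards [eventually_ge_atTop N] with m hm
  have hpos : (0 : ℝ) < (m.descFactorial N : ℝ) ^ 2 := by
    have : 0 < m.descFactorial N := Nat.pos_of_ne_zero (by
      rw [Ne, Nat.descFactorial_eq_zero_iff_lt]; omega)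
    positivity
  have hcard : (Fintype.card ((Fin N ↪ Fin m) × (Fin N ↪ Fin m)) : ℝ) =
      (m.descFactorial N : ℝ) ^ 2 := by
    simp [Fintype.card_embedding_eq, sq]
  -- Testing disjointness of the full ranges, not just of the images of `A` and `B`, gives a count
  -- independent of `A` and `B`.
  have hle : ∀ p : (Fin N ↪ Fin m) × (Fin N ↪ Fin m),
      |h (A.map p.1 ∩ B.map p.2).card - h 0| ≤
        C - if Disjoint (Finset.univ.map p.1) (Finset.univ.map p.2) then C else 0 := by
    intro p
    split_ifs with hd
    · have : Disjoint (A.map p.1) (B.map p.2) :=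
        hd.mono (Finset.map_subset_map.2 (Finset.subset_univ _))
          (Finset.map_subset_map.2 (Finset.subset_univ _))
      simp [Finset.disjoint_iff_inter_eq_empty.1 this]
    · rw [sub_zero, hC]
      refine Finset.single_le_sum (f := fun k => |h k - h 0|) (fun _ _ => abs_nonneg _) ?_
      have h1 := Finset.card_le_card (Finset.inter_subset_left (s₁ := A.map p.1) (s₂ := B.map p.2))
      have h2 := A.card_le_univ
      simp only [Finset.card_map, Fintype.card_fin] at h1 h2
      exact Finset.mem_range.2 (by omega)
  have hsum := (Finset.abs_sum_le_sum_abs (fun p : (Fin N ↪ Fin m) × (Fin N ↪ Fin m) =>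
    h (A.map p.1 ∩ B.map p.2).card - h 0) Finset.univ).trans
      (Finset.sum_le_sum fun p _ => hle p)
  simp only [Finset.sum_sub_distrib, Finset.sum_const, nsmul_eq_mul, Finset.card_univ, hcard,
    ← Finset.sum_filter, card_filter_disjoint_range, Fintype.card_fin] at hsum
  have e1 : (∑ p : (Fin N ↪ Fin m) × (Fin N ↪ Fin m), h (A.map p.1 ∩ B.map p.2).card) /
      (m.descFactorial N : ℝ) ^ 2 - h 0 =
      ((∑ p : (Fin N ↪ Fin m) × (Fin N ↪ Fin m), h (A.map p.1 ∩ B.map p.2).card) -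
        (m.descFactorial N : ℝ) ^ 2 * h 0) / (m.descFactorial N : ℝ) ^ 2 := by
    rw [sub_div, mul_div_cancel_left₀ _ hpos.ne']
  have e2 : C * (1 - (m.descFactorial (N + N) : ℝ) / (m.descFactorial N : ℝ) ^ 2) =
      ((m.descFactorial N : ℝ) ^ 2 * C - (m.descFactorial (N + N) : ℝ) * C) /
        (m.descFactorial N : ℝ) ^ 2 := by
    rw [sub_div, mul_div_cancel_left₀ _ hpos.ne']
    ring
  rw [e1, e2, Real.norm_eq_abs, abs_div, abs_of_pos hpos]
  gcongr

/-! ### Index assignments mixing data and random points -/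

/-- The assignment of indices sending the positions in `A` to data points through `f` and the
other positions to random points through `g`. -/
def mixedIndex {ι κ κ' : Type*} [DecidableEq ι] (A : Finset ι) (f : ι ↪ κ) (g : ι ↪ κ') :
    ι ↪ κ ⊕ κ' where
  toFun j := if j ∈ A then Sum.inl (f j) else Sum.inr (g j)
  inj' a b h := by
    by_cases ha : a ∈ A <;> by_cases hb : b ∈ A <;> simp [ha, hb] at h <;> exact h

theorem mixedIndex_apply {ι κ κ' : Type*} [DecidableEq ι] (A : Finset ι) (f : ι ↪ κ)
    (g : ι ↪ κ') (j : ι) :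
    mixedIndex A f g j = if j ∈ A then Sum.inl (f j) else Sum.inr (g j) := rfl

theorem univ_map_mixedIndex {ι κ κ' : Type*} [Fintype ι] [DecidableEq ι] (A : Finset ι)
    (f : ι ↪ κ) (g : ι ↪ κ') :
    Finset.univ.map (mixedIndex A f g) = (A.map f).disjSum (Aᶜ.map g) := by
  ext x
  cases x with
  | inl x =>
    simp only [mixedIndex_apply, Finset.mem_map, Finset.mem_univ, true_and, Finset.inl_mem_disjSum]
    refine ⟨fun ⟨a, ha⟩ => ?_, fun ⟨a, ha, h⟩ => ⟨a, by simp [ha, h]⟩⟩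
    by_cases h : a ∈ A
    · exact ⟨a, h, by simpa [h] using ha⟩
    · simp [h] at ha
  | inr x =>
    simp only [mixedIndex_apply, Finset.mem_map, Finset.mem_univ, true_and, Finset.inr_mem_disjSum, Finset.mem_compl]
    refine ⟨fun ⟨a, ha⟩ => ?_, fun ⟨a, ha, h⟩ => ⟨a, by simp [ha, h]⟩⟩
    by_cases h : a ∈ A
    · simp [h] at ha
    · exact ⟨a, h, by simpa [h] using ha⟩

theorem card_inter_map_mixedIndex {ι κ κ' : Type*} [Fintype ι] [DecidableEq ι] [DecidableEq κ]
    [DecidableEq κ'] (A B : Finset ι) (f f' : ι ↪ κ) (g g' : ι ↪ κ') :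
    (Finset.univ.map (mixedIndex A f g) ∩ Finset.univ.map (mixedIndex B f' g')).card =
      (A.map f ∩ B.map f').card + (Aᶜ.map g ∩ Bᶜ.map g').card := by
  rw [univ_map_mixedIndex, univ_map_mixedIndex, ← Finset.card_disjSum]
  congr 1
  ext x
  cases x <;> simp only [Finset.mem_inter, Finset.inl_mem_disjSum, Finset.inr_mem_disjSum]

/-- The equivalence splitting `N` positions into the first `k` and the last `N - k`. -/
def splitPositions {N k : ℕ} (hk : k ≤ N) : Fin N ≃ Fin k ⊕ Fin (N - k) :=
  (finCongr (by omega)).trans finSumFinEquiv.symm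

theorem joinPts_eq {E : Type*} {N k : ℕ} (hk : k ≤ N) (x : Fin k → E) (y : Fin (N - k) → E) :
    joinPts x y = Sum.elim x y ∘ splitPositions hk := by
  have : joinPts x y ∘ (splitPositions hk).symm = Sum.elim x y := by
    ext s
    cases s with
    | inl i => simp [splitPositions, joinPts]
    | inr i => simp [splitPositions, joinPts]
  rw [← this]
  ext j
  simp

/-- Symmetry frees the order fixed by `joinPts`: any splitting of the positions will do, in
particular one adapted to a given subset. -/
theorem IsSymmFun.apply_joinPts {E : Type*} {N k : ℕ} {Φ : (Fin N → E) → ℝ} (h : IsSymmFun Φ)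
    (hk : k ≤ N) (e : Fin N ≃ Fin k ⊕ Fin (N - k)) (x : Fin k → E) (y : Fin (N - k) → E) :
    Φ (joinPts x y) = Φ (Sum.elim x y ∘ e) := by
  rw [joinPts_eq hk, ← h (e.trans (splitPositions hk).symm)]
  congr 1
  ext j
  simp

theorem exists_equiv_sum_of_card {N : ℕ} (A : Finset (Fin N)) {k : ℕ} (hA : A.card = k) :
    ∃ e : Fin N ≃ Fin k ⊕ Fin (N - k), (∀ i, e.symm (Sum.inl i) ∈ A) ∧
      ∀ i, e.symm (Sum.inr i) ∉ A := by
  have e1 : {j // j ∈ A} ≃ Fin k := Fintype.equivFinOfCardEq (by simp [hA])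
  have e2 : {j // j ∉ A} ≃ Fin (N - k) := Fintype.equivFinOfCardEq (by
    rw [Fintype.card_subtype_compl]; simp [hA])
  refine ⟨(Equiv.sumCompl fun j => j ∈ A).symm.trans (Equiv.sumCongr e1 e2), fun i => ?_,
    fun i => ?_⟩
  · simp
  · simpa using (e2.symm i).2

theorem sum_joinPts_div {E : Type*} {N n m : ℕ} (hn : N ≤ n) (hm : N ≤ m)
    {Φ : (Fin N → E) → ℝ} (h : IsSymmFun Φ) (u : Fin n → E) (w : Fin m → E)
    (A : Finset (Fin N)) :
    (∑ x : Fin A.card ↪ Fin n, ∑ y : Fin (N - A.card) ↪ Fin m,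
        Φ (joinPts (u ∘ x) (w ∘ y))) / n.descFactorial A.card / m.descFactorial (N - A.card) =
      (∑ f : Fin N ↪ Fin n, ∑ g : Fin N ↪ Fin m, Φ (Sum.elim u w ∘ mixedIndex A f g)) /
        n.descFactorial N / m.descFactorial N := by
  obtain ⟨e, he1, he2⟩ := exists_equiv_sum_of_card A rfl
  have hk : A.card ≤ N := by simpa using A.card_le_univ
  have key : ∀ (f : Fin N ↪ Fin n) (g : Fin N ↪ Fin m),
      Φ (Sum.elim u w ∘ mixedIndex A f g) =
        Φ (joinPts (u ∘ fun i => f (e.symm (Sum.inl i)))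
          (w ∘ fun i => g (e.symm (Sum.inr i)))) := by
    intro f g
    rw [h.apply_joinPts hk e]
    congr 1
    ext j
    obtain ⟨s, rfl⟩ := e.symm.surjective j
    cases s with
    | inl i => simp [mixedIndex_apply, he1]
    | inr i => simp [mixedIndex_apply, he2]
  simp only [key]
  have s1 := sum_embedding_restrict_div (γ := Fin n) e (by simpa using hn)
    (fun x => ∑ g : Fin N ↪ Fin m, Φ (joinPts (u ∘ x) (w ∘ fun i => g (e.symm (Sum.inr i)))))
  simp only [Fintype.card_fin] at s1
  rw [s1, Finset.sum_div, Finset.sum_div, Finset.sum_div, Finset.sum_div]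
  refine Finset.sum_congr rfl fun x _ => ?_
  -- The summands are swapped because the positions kept by `g` are the complement of `A`, the right
  -- summand of `e`.
  have s2 := sum_embedding_restrict_div (γ := Fin m) (e.trans (Equiv.sumComm _ _))
    (by simpa using hm) (fun y => Φ (joinPts (u ∘ x) (w ∘ y)))
  simp only [Fintype.card_fin, Equiv.symm_trans_apply, Equiv.sumComm_symm, Equiv.sumComm_apply,
    Sum.swap_inl] at s2
  rw [div_right_comm, div_right_comm (∑ g : Fin N ↪ Fin m, _), ← s2]

/-! ### Moments of functions of independent uniform points -/

theorem map_comp_eq_smul_pi {Ω E ι κ : Type*} [MeasurableSpace Ω] [MeasureSpace E]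
    [SigmaFinite (volume : Measure E)] [Fintype κ]
    {P : Measure Ω} [IsProbabilityMeasure P] {W : Set E} (hW0 : volume W ≠ 0)
    (hWtop : volume W ≠ ⊤) {Z : ι → Ω → E} (hind : iIndepFun Z P)
    (hu : ∀ i, pdf.IsUniform (Z i) W P volume) {r : κ → ι} (hr : Function.Injective r) :
    P.map (fun ω j => Z (r j) ω) =
      (volume W)⁻¹ ^ Fintype.card κ • Measure.pi fun _ : κ => (volume : Measure E).restrict W := by
  rw [(iIndepFun_iff_map_fun_eq_pi_map
    (fun j => pdf.IsUniform.aemeasurable hW0 hWtop (hu (r j)))).1 (hind.precomp hr)]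
  have h : ∀ i, P.map (Z i) = (volume W)⁻¹ • (volume : Measure E).restrict W := fun i => hu i
  have hfin : SigmaFinite ((volume W)⁻¹ • (volume : Measure E).restrict W) := by
    have : IsFiniteMeasure ((volume W)⁻¹ • (volume : Measure E).restrict W) :=
      ⟨by simp [ENNReal.inv_mul_cancel hW0 hWtop]⟩
    infer_instance
  simp only [h]
  refine Measure.pi_eq fun s _ => ?_
  simp [Measure.pi_pi, Finset.prod_mul_distrib]

theorem aemeasurable_comp {Ω E ι κ : Type*} [MeasurableSpace Ω] [MeasureSpace E]
    [Countable κ] {P : Measure Ω} {W : Set E} (hW0 : volume W ≠ 0)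
    (hWtop : volume W ≠ ⊤) {Z : ι → Ω → E} (hu : ∀ i, pdf.IsUniform (Z i) W P volume)
    (r : κ → ι) : AEMeasurable (fun ω j => Z (r j) ω) P :=
  aemeasurable_pi_iff.2 fun j => pdf.IsUniform.aemeasurable hW0 hWtop (hu (r j))

theorem measurePreserving_splitTriple {d : ℕ} (W : Set (EuclideanSpace ℝ (Fin d))) (N k : ℕ) :
    MeasurePreserving
      (fun t : Fin k ⊕ (Fin (N - k) ⊕ Fin (N - k)) → EuclideanSpace ℝ (Fin d) =>
        (fun i => t (Sum.inl i), fun i => t (Sum.inr (Sum.inl i)),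
          fun i => t (Sum.inr (Sum.inr i))))
      (Measure.pi fun _ => volume.restrict W) (sharedMeasure W N k) :=
  ((MeasurePreserving.id _).prod (measurePreserving_sumPiEquivProdPi
    (fun _ : Fin (N - k) ⊕ Fin (N - k) => volume.restrict W))).comp
    (measurePreserving_sumPiEquivProdPi
      (fun _ : Fin k ⊕ (Fin (N - k) ⊕ Fin (N - k)) => volume.restrict W))

section
variable {d N : ℕ} {W : Set (EuclideanSpace ℝ (Fin d))}
  {Ω ι : Type*} [MeasurableSpace Ω] {P : Measure Ω} [IsProbabilityMeasure P]
  {Z : ι → Ω → EuclideanSpace ℝ (Fin d)}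

theorem integrable_comp_and_integral_eq (hW0 : volume W ≠ 0) (hWtop : volume W ≠ ⊤)
    (hind : iIndepFun Z P) (hu : ∀ i, pdf.IsUniform (Z i) W P volume)
    {Φ : (Fin N → EuclideanSpace ℝ (Fin d)) → ℝ} (hi : Integrable Φ (domMeasure W N))
    (p : Fin N ↪ ι) :
    Integrable (fun ω => Φ fun j => Z (p j) ω) P ∧
      ∫ ω, Φ (fun j => Z (p j) ω) ∂P = phaseTotal W Φ / volume.real W ^ N := by
  have hmap := map_comp_eq_smul_pi hW0 hWtop hind hu p.injective
  have hmeas := aemeasurable_comp hW0 hWtop hu p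
  have hc : (volume W)⁻¹ ^ Fintype.card (Fin N) ≠ ⊤ := by simp [hW0]
  have hi' : Integrable Φ (P.map fun ω j => Z (p j) ω) := by
    rw [hmap]; exact hi.smul_measure hc
  refine ⟨(integrable_map_measure hi'.aestronglyMeasurable hmeas).1 hi', ?_⟩
  rw [← integral_map hmeas hi'.aestronglyMeasurable, hmap, integral_smul_measure]
  simp [phaseTotal, domMeasure, Measure.real, div_eq_inv_mul]

/-- The joint law of `2N - k` distinct points contributes `v^(-(2N - k))`; writing it as `v^k /
v^(2N)` makes the denominator independent of the overlap. -/
theorem integrable_sharedProduct_comp_and_integral_eq (hW0 : volume W ≠ 0)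
    (hWtop : volume W ≠ ⊤) (hind : iIndepFun Z P)
    (hu : ∀ i, pdf.IsUniform (Z i) W P volume)
    {Φa Φb : (Fin N → EuclideanSpace ℝ (Fin d)) → ℝ} {k : ℕ} (hk : k ≤ N)
    (hi : Integrable (sharedProduct Φa Φb k) (sharedMeasure W N k))
    {r : Fin k ⊕ (Fin (N - k) ⊕ Fin (N - k)) → ι} (hr : Function.Injective r) :
    Integrable (fun ω => sharedProduct Φa Φb k (fun i => Z (r (Sum.inl i)) ω,
        fun i => Z (r (Sum.inr (Sum.inl i))) ω, fun i => Z (r (Sum.inr (Sum.inr i))) ω)) P ∧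
      ∫ ω, sharedProduct Φa Φb k (fun i => Z (r (Sum.inl i)) ω,
        fun i => Z (r (Sum.inr (Sum.inl i))) ω, fun i => Z (r (Sum.inr (Sum.inr i))) ω) ∂P =
        volume.real W ^ k * phaseShared W Φa Φb k / volume.real W ^ (2 * N) := by
  have hmeas := aemeasurable_comp hW0 hWtop hu r
  have hT := measurePreserving_splitTriple W N k
  have hmap : P.map (fun ω => ((fun i => Z (r (Sum.inl i)) ω,
        fun i => Z (r (Sum.inr (Sum.inl i))) ω, fun i => Z (r (Sum.inr (Sum.inr i))) ω) :
        (Fin k → EuclideanSpace ℝ (Fin d)) × (Fin (N - k) → EuclideanSpace ℝ (Fin d)) ×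
          (Fin (N - k) → EuclideanSpace ℝ (Fin d)))) =
      (volume W)⁻¹ ^ (k + ((N - k) + (N - k))) • sharedMeasure W N k := by
    have := AEMeasurable.map_map_of_aemeasurable hT.measurable.aemeasurable hmeas
    rw [map_comp_eq_smul_pi hW0 hWtop hind hu hr, Measure.map_smul, hT.map_eq] at this
    simpa [Function.comp_def] using this.symm
  have hmeas' : AEMeasurable (fun ω => ((fun i => Z (r (Sum.inl i)) ω,
        fun i => Z (r (Sum.inr (Sum.inl i))) ω, fun i => Z (r (Sum.inr (Sum.inr i))) ω) :
        (Fin k → EuclideanSpace ℝ (Fin d)) × (Fin (N - k) → EuclideanSpace ℝ (Fin d)) ×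
          (Fin (N - k) → EuclideanSpace ℝ (Fin d)))) P :=
    hT.measurable.comp_aemeasurable hmeas
  have hc : (volume W)⁻¹ ^ (k + ((N - k) + (N - k))) ≠ ⊤ := by simp [hW0]
  have hi' := hi.smul_measure hc
  rw [← hmap] at hi'
  refine ⟨(integrable_map_measure hi'.aestronglyMeasurable hmeas').1 hi', ?_⟩
  rw [← integral_map hmeas' hi'.aestronglyMeasurable, hmap, integral_smul_measure]
  have hv : volume.real W ≠ 0 := by simp [Measure.real, ENNReal.toReal_eq_zero_iff, hW0, hWtop]
  have hpow : volume.real W ^ (2 * N) =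
      volume.real W ^ k * volume.real W ^ (k + ((N - k) + (N - k))) := by
    rw [← pow_add]; congr 1; omega
  rw [hpow, mul_div_mul_left _ _ (pow_ne_zero _ hv), div_eq_inv_mul]
  simp [phaseShared, Measure.real]

/-- Normal form matching `sharedProduct`: after reordering positions, both injections factor through
a single injection `r` listing the shared indices, then those proper to `p`, then those proper to
`q`. -/
theorem exists_sharing_split [DecidableEq ι] (p q : Fin N ↪ ι) {k : ℕ}
    (hpq : (Finset.univ.map p ∩ Finset.univ.map q).card = k) :
    ∃ (r : Fin k ⊕ (Fin (N - k) ⊕ Fin (N - k)) → ι) (e e' : Fin N ≃ Fin k ⊕ Fin (N - k)),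
      Function.Injective r ∧
      (p : Fin N → ι) =
        Sum.elim (r ∘ Sum.inl) (r ∘ Sum.inr ∘ Sum.inl) ∘ e ∧
      (q : Fin N → ι) =
        Sum.elim (r ∘ Sum.inl) (r ∘ Sum.inr ∘ Sum.inr) ∘ e' := by
  set S := Finset.univ.map p ∩ Finset.univ.map q with hS
  have aux : ∀ f : Fin N ↪ ι, S ⊆ Finset.univ.map f → ∃ e : Fin N ≃ Fin k ⊕ Fin (N - k),
      (∀ i, f (e.symm (Sum.inl i)) ∈ S) ∧ ∀ i, f (e.symm (Sum.inr i)) ∉ S := by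
    intro f hf
    have hcard : (Finset.univ.filter fun j => f j ∈ S).card = k := by
      rw [← hpq, ← Finset.card_map f]
      congr 1
      ext x
      simp only [Finset.mem_map, Finset.mem_filter, Finset.mem_univ, true_and]
      refine ⟨fun ⟨a, ha, h⟩ => h ▸ ha, fun hx => ?_⟩
      obtain ⟨a, -, rfl⟩ := Finset.mem_map.1 (hf hx)
      exact ⟨a, hx, rfl⟩
    obtain ⟨e, h1, h2⟩ := exists_equiv_sum_of_card _ hcard
    exact ⟨e, fun i => by simpa using h1 i, fun i => by simpa using h2 i⟩
  obtain ⟨e, he1, he2⟩ := aux p Finset.inter_subset_left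
  obtain ⟨e₀, hq1, hq2⟩ := aux q Finset.inter_subset_right
  have hx : ∀ i : Fin k, ∃ i' : Fin k, q (e₀.symm (Sum.inl i')) = p (e.symm (Sum.inl i)) := by
    intro i
    have h1 := he1 i
    obtain ⟨b, -, hb⟩ := Finset.mem_map.1 (Finset.inter_subset_right h1)
    obtain ⟨s, rfl⟩ := e₀.symm.surjective b
    cases s with
    | inl i' => exact ⟨i', hb⟩
    | inr i' => exact absurd (hb ▸ h1) (hq2 i')
  choose t ht using hx
  have htinj : Function.Injective t := fun i j hij => by
    have := (ht i).symm.trans ((by rw [hij] : _ = _).trans (ht j))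
    simpa using this
  -- `p` and `q` may list the shared indices in different orders; `τ` reconciles them.
  let τ : Fin k ≃ Fin k := Equiv.ofBijective t (Finite.injective_iff_bijective.1 htinj)
  refine ⟨Sum.elim (fun i => p (e.symm (Sum.inl i)))
    (Sum.elim (fun i => p (e.symm (Sum.inr i))) fun i => q (e₀.symm (Sum.inr i))), e,
    e₀.trans (Equiv.sumCongr τ.symm (Equiv.refl _)), ?_, ?_, ?_⟩
  · have hmemp : ∀ j, p j ∈ Finset.univ.map p := fun j => by simp
    have hmemq : ∀ j, q j ∈ Finset.univ.map q := fun j => by simp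
    refine Function.Injective.sumElim (fun i j h => by simpa using h)
      (Function.Injective.sumElim (fun i j h => by simpa using h)
        (fun i j h => by simpa using h) fun i j h => ?_) fun i s h => ?_
    · exact he2 i (Finset.mem_inter.2 ⟨hmemp _, h ▸ hmemq _⟩)
    · cases s with
      | inl j => simp at h
      | inr j => exact hq2 j ((show p _ = q _ from h) ▸ he1 i)
  · ext j
    obtain ⟨s, rfl⟩ := e.symm.surjective j
    cases s <;> simp
  · ext j
    obtain ⟨s, rfl⟩ := e₀.symm.surjective j
    cases s with
    | inl i =>
      obtain ⟨i, rfl⟩ := τ.surjective i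
      simp [← ht, τ]
    | inr i => simp

theorem integrable_mul_comp_and_integral_eq [DecidableEq ι] (hW0 : volume W ≠ 0)
    (hWtop : volume W ≠ ⊤) (hind : iIndepFun Z P)
    (hu : ∀ i, pdf.IsUniform (Z i) W P volume)
    {Φa Φb : (Fin N → EuclideanSpace ℝ (Fin d)) → ℝ} (hsa : IsSymmFun Φa) (hsb : IsSymmFun Φb)
    (hS : ∀ k ≤ N, Integrable (sharedProduct Φa Φb k) (sharedMeasure W N k))
    (p q : Fin N ↪ ι) :
    Integrable (fun ω => Φa (fun j => Z (p j) ω) * Φb fun j => Z (q j) ω) P ∧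
      ∫ ω, Φa (fun j => Z (p j) ω) * Φb (fun j => Z (q j) ω) ∂P =
        volume.real W ^ (Finset.univ.map p ∩ Finset.univ.map q).card *
          phaseShared W Φa Φb (Finset.univ.map p ∩ Finset.univ.map q).card /
          volume.real W ^ (2 * N) := by
  have hk : (Finset.univ.map p ∩ Finset.univ.map q).card ≤ N := by
    simpa using Finset.card_le_card
      (Finset.inter_subset_left (s₁ := Finset.univ.map p) (s₂ := Finset.univ.map q))
  generalize hkk : (Finset.univ.map p ∩ Finset.univ.map q).card = k at *
  obtain ⟨r, e, e', hr, hp, hq⟩ := exists_sharing_split p q hkk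
  have key : ∀ ω, Φa (fun j => Z (p j) ω) * Φb (fun j => Z (q j) ω) =
      sharedProduct Φa Φb k (fun i => Z (r (Sum.inl i)) ω,
        fun i => Z (r (Sum.inr (Sum.inl i))) ω, fun i => Z (r (Sum.inr (Sum.inr i))) ω) := by
    intro ω
    rw [sharedProduct, hsa.apply_joinPts hk e, hsb.apply_joinPts hk e', hp, hq]
    congr 2
    · ext1 j
      simp only [Function.comp_apply]
      cases e j <;> rfl
    · ext1 j
      simp only [Function.comp_apply]
      cases e' j <;> rfl
  simp only [key]
  exact integrable_sharedProduct_comp_and_integral_eq hW0 hWtop hind hu hk (hS k hk) hr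
end

/-! ### Distinctness of the points and linear combinations of samples -/

/-- For `d ≥ 1` the uniform law has no atoms, so the diagonal is null for the product law of two
points. Catalogs are sets, hence sums over them match sums over indices only off this null event. -/
theorem ae_injective_of_uniform {Ω ι : Type*} [Finite ι] [MeasurableSpace Ω] {P : Measure Ω}
    [IsProbabilityMeasure P] {d : ℕ} (hd : 1 ≤ d) {W : Set (EuclideanSpace ℝ (Fin d))}
    (hW0 : volume W ≠ 0) (hWtop : volume W ≠ ⊤) {Z : ι → Ω → EuclideanSpace ℝ (Fin d)}
    (hind : iIndepFun Z P) (hu : ∀ i, pdf.IsUniform (Z i) W P volume) :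
    ∀ᵐ ω ∂P, Function.Injective fun i => Z i ω := by
  have : Nonempty (Fin d) := ⟨⟨0, hd⟩⟩
  have key : ∀ i j, i ≠ j → ∀ᵐ ω ∂P, Z i ω ≠ Z j ω := by
    intro i j hij
    have hmi := pdf.IsUniform.aemeasurable hW0 hWtop (hu i)
    have hmj := pdf.IsUniform.aemeasurable hW0 hWtop (hu j)
    have h1 := (indepFun_iff_map_prod_eq_prod_map_map hmi hmj).1 (hind.indepFun hij)
    have h2 : ∀ᵐ x ∂(P.map fun ω => (Z i ω, Z j ω)), x.1 ≠ x.2 := by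
      rw [h1]
      have : IsProbabilityMeasure (P.map (Z j)) := Measure.isProbabilityMeasure_map hmj
      have hm : MeasurableSet {x : EuclideanSpace ℝ (Fin d) × EuclideanSpace ℝ (Fin d) |
          x.1 = x.2} := measurableSet_eq_fun measurable_fst measurable_snd
      rw [ae_iff]
      simp only [ne_eq, not_not]
      refine (Measure.measure_prod_null hm).2 (Eventually.of_forall fun x => ?_)
      have hx : Prod.mk x ⁻¹' {x : EuclideanSpace ℝ (Fin d) × EuclideanSpace ℝ (Fin d) |
          x.1 = x.2} = {x} := by
        ext y; simp [eq_comm]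
      simp only [hx]
      exact (hu j).absolutelyContinuous (measure_singleton x)
    exact ae_of_ae_map (hmi.prodMk hmj) h2
  have hall : ∀ᵐ ω ∂P, ∀ i j, i ≠ j → Z i ω ≠ Z j ω := by
    refine ae_all_iff.2 fun i => ae_all_iff.2 fun j => ?_
    by_cases hij : i = j
    · simp [hij]
    · filter_upwards [key i j hij] with ω h _ using h
  filter_upwards [hall] with ω h i j hij
  by_contra hne
  exact h i j hne hij

section
variable {d N : ℕ} {W : Set (EuclideanSpace ℝ (Fin d))}
  {Ω ι : Type*} [MeasurableSpace Ω] {P : Measure Ω} [IsProbabilityMeasure P]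
  {Z : ι → Ω → EuclideanSpace ℝ (Fin d)} {T : Type*} [Fintype T]

theorem integrable_linear_comp_and_integral_eq (hW0 : volume W ≠ 0) (hWtop : volume W ≠ ⊤)
    (hind : iIndepFun Z P) (hu : ∀ i, pdf.IsUniform (Z i) W P volume)
    {Φ : (Fin N → EuclideanSpace ℝ (Fin d)) → ℝ} (hi : Integrable Φ (domMeasure W N))
    (c : T → ℝ) (p : T → Fin N ↪ ι) :
    Integrable (fun ω => ∑ t, c t * Φ fun j => Z (p t j) ω) P ∧
      ∫ ω, ∑ t, c t * Φ (fun j => Z (p t j) ω) ∂P =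
        (∑ t, c t) * (phaseTotal W Φ / volume.real W ^ N) := by
  have h := fun t => integrable_comp_and_integral_eq hW0 hWtop hind hu hi (p t)
  have h' : ∀ t, Integrable (fun ω => c t * Φ fun j => Z (p t j) ω) P :=
    fun t => (h t).1.const_mul _
  refine ⟨integrable_finsetSum _ fun t _ => h' t, ?_⟩
  rw [integral_finsetSum _ fun t _ => h' t, Finset.sum_mul]
  exact Finset.sum_congr rfl fun t _ => by rw [integral_const_mul, (h t).2]

theorem integrable_linear_mul_comp_and_integral_eq [DecidableEq ι] (hW0 : volume W ≠ 0)
    (hWtop : volume W ≠ ⊤) (hind : iIndepFun Z P)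
    (hu : ∀ i, pdf.IsUniform (Z i) W P volume)
    {Φa Φb : (Fin N → EuclideanSpace ℝ (Fin d)) → ℝ} (hsa : IsSymmFun Φa) (hsb : IsSymmFun Φb)
    (hS : ∀ k ≤ N, Integrable (sharedProduct Φa Φb k) (sharedMeasure W N k))
    (c : T → ℝ) (p : T → Fin N ↪ ι) :
    Integrable (fun ω => (∑ t, c t * Φa fun j => Z (p t j) ω) *
        ∑ t, c t * Φb fun j => Z (p t j) ω) P ∧
      ∫ ω, (∑ t, c t * Φa fun j => Z (p t j) ω) * (∑ t, c t * Φb fun j => Z (p t j) ω) ∂P =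
        ∑ t, ∑ t', c t * c t' *
          (volume.real W ^ (Finset.univ.map (p t) ∩ Finset.univ.map (p t')).card *
          phaseShared W Φa Φb (Finset.univ.map (p t) ∩ Finset.univ.map (p t')).card /
          volume.real W ^ (2 * N)) := by
  have h := fun t t' =>
    integrable_mul_comp_and_integral_eq hW0 hWtop hind hu hsa hsb hS (p t) (p t')
  have e : ∀ ω, (∑ t, c t * Φa fun j => Z (p t j) ω) * (∑ t, c t * Φb fun j => Z (p t j) ω) =
      ∑ t, ∑ t', c t * c t' * (Φa (fun j => Z (p t j) ω) * Φb fun j => Z (p t' j) ω) := by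
    intro ω
    rw [Finset.sum_mul_sum]
    exact Finset.sum_congr rfl fun t _ => Finset.sum_congr rfl fun t' _ => by ring
  have h' : ∀ t t', Integrable (fun ω => c t * c t' *
      (Φa (fun j => Z (p t j) ω) * Φb fun j => Z (p t' j) ω)) P :=
    fun t t' => (h t t').1.const_mul _
  simp only [e]
  refine ⟨integrable_finsetSum _ fun t _ => integrable_finsetSum _ fun t' _ => h' t t', ?_⟩
  rw [integral_finsetSum _ fun t _ => integrable_finsetSum _ fun t' _ => h' t t']
  refine Finset.sum_congr rfl fun t _ => ?_
  rw [integral_finsetSum _ fun t' _ => h' t t']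
  exact Finset.sum_congr rfl fun t' _ => by rw [integral_const_mul, (h t t').2]
end

/-! ### The estimator as a linear combination over index assignments -/

theorem tupleSum_image {E : Type*} [DecidableEq E] {N n m : ℕ} (Φ : (Fin N → E) → ℝ) (k : ℕ)
    {u : Fin n → E} {w : Fin m → E} (hu : Function.Injective u) (hw : Function.Injective w) :
    tupleSum Φ k (Finset.univ.image u) (Finset.univ.image w) =
      ∑ x : Fin k ↪ Fin n, ∑ y : Fin (N - k) ↪ Fin m, Φ (joinPts (u ∘ x) (w ∘ y)) := by
  have eqv : ∀ {l : ℕ} (v : Fin l → E), Function.Injective v →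
      ∃ e : Fin l ≃ {x // x ∈ Finset.univ.image v}, ∀ i, (e i : E) = v i := by
    intro l v hv
    refine ⟨Equiv.ofBijective (fun i => ⟨v i, by simp⟩) ⟨fun i j h => hv (by simpa using h), ?_⟩,
      fun i => rfl⟩
    rintro ⟨x, hx⟩
    obtain ⟨i, -, rfl⟩ := Finset.mem_image.1 hx
    exact ⟨i, rfl⟩
  obtain ⟨e, he⟩ := eqv u hu
  obtain ⟨e', he'⟩ := eqv w hw
  rw [tupleSum, ← Equiv.sum_comp (Equiv.embeddingCongr (Equiv.refl _) e)]
  refine Finset.sum_congr rfl fun x _ => ?_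
  rw [← Equiv.sum_comp (Equiv.embeddingCongr (Equiv.refl _) e')]
  refine Finset.sum_congr rfl fun y _ => ?_
  congr 2
  · ext1 j; exact he _
  · ext1 j; exact he' _

theorem joinPts_comp_inl_inr_injective {N n m k : ℕ} (hk : k ≤ N) (x : Fin k ↪ Fin n)
    (y : Fin (N - k) ↪ Fin m) :
    Function.Injective
      (joinPts (fun i => (Sum.inl (x i) : Fin n ⊕ Fin m)) fun i => Sum.inr (y i)) := by
  rw [joinPts_eq hk]
  exact (Function.Injective.sumElim (fun i j h => by simpa using h) (fun i j h => by simpa using h)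
    fun i j => by simp).comp (splitPositions hk).injective

/-- Used for integrability, which is claimed for every `m`, including `m < N` where the spreading
over full injections fails. The coefficients and assignments precede `Φ`, so one representation
serves both `Φa` and `Φb`. -/
theorem exists_edgeEstimator_eq_linear {d N : ℕ} (W : Set (EuclideanSpace ℝ (Fin d)))
    (n m : ℕ) :
    ∃ (T : Type) (_ : Fintype T) (c : T → ℝ) (p : T → Fin N ↪ Fin n ⊕ Fin m),
      ∀ (Φ : (Fin N → EuclideanSpace ℝ (Fin d)) → ℝ) (u : Fin n → EuclideanSpace ℝ (Fin d))
        (w : Fin m → EuclideanSpace ℝ (Fin d)), Function.Injective u → Function.Injective w →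
        ∀ D R : Finset (EuclideanSpace ℝ (Fin d)), (D : Set _) = Set.range u →
          (R : Set _) = Set.range w →
        edgeEstimator W Φ n m D R =
          1 / phaseTotal W Φ * ∑ t, c t * Φ fun j => Sum.elim u w (p t j) := by
  classical
  refine ⟨Σ i : Fin (N + 1), (Fin i ↪ Fin n) × (Fin (N - i) ↪ Fin m), inferInstance,
    fun t => (N.choose t.1 : ℝ) * (-1) ^ (N - (t.1 : ℕ)) *
      (volume.real W ^ (t.1 : ℕ) / (n.descFactorial t.1 : ℝ)) *
      (volume.real W ^ (N - (t.1 : ℕ)) / (m.descFactorial (N - t.1) : ℝ)),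
    fun t => ⟨_, joinPts_comp_inl_inr_injective (Nat.lt_succ_iff.1 t.1.2) t.2.1 t.2.2⟩, ?_⟩
  intro Φ u w hu hw D R hD hR
  obtain rfl : D = Finset.univ.image u := by
    apply Finset.coe_injective; simp [hD]
  obtain rfl : R = Finset.univ.image w := by
    apply Finset.coe_injective; simp [hR]
  rw [edgeEstimator, Finset.sum_range, Fintype.sum_sigma]
  congr 1
  refine Finset.sum_congr rfl fun i _ => ?_
  rw [tupleSum_image Φ _ hu hw, Fintype.sum_prod_type, Finset.mul_sum]
  refine Finset.sum_congr rfl fun x _ => ?_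
  rw [Finset.mul_sum]
  refine Finset.sum_congr rfl fun y _ => ?_
  congr 2
  ext1 j
  simp only [Function.Embedding.coeFn_mk, joinPts]
  split_ifs <;> rfl

/-- The coefficient `N.choose i` counts the sets `A` of size `i`, and `sum_joinPts_div` spreads each
normalized tuple sum over full injections. Apart from the sign, all weights become equal. -/
theorem edgeEstimator_eq_sum_mixedIndex {d N n m : ℕ} (hn : N ≤ n) (hm : N ≤ m)
    (W : Set (EuclideanSpace ℝ (Fin d)))
    {Φ : (Fin N → EuclideanSpace ℝ (Fin d)) → ℝ} (h : IsSymmFun Φ)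
    {u : Fin n → EuclideanSpace ℝ (Fin d)} {w : Fin m → EuclideanSpace ℝ (Fin d)}
    (hu : Function.Injective u) (hw : Function.Injective w)
    {D R : Finset (EuclideanSpace ℝ (Fin d))} (hD : (D : Set _) = Set.range u)
    (hR : (R : Set _) = Set.range w) :
    edgeEstimator W Φ n m D R =
      (-1) ^ N * volume.real W ^ N / (phaseTotal W Φ * n.descFactorial N * m.descFactorial N) *
        ∑ t : Finset (Fin N) × (Fin N ↪ Fin n) × (Fin N ↪ Fin m),
          (-1) ^ t.1.card * Φ fun j => Sum.elim u w (mixedIndex t.1 t.2.1 t.2.2 j) := by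
  classical
  obtain rfl : D = Finset.univ.image u := by
    apply Finset.coe_injective; simp [hD]
  obtain rfl : R = Finset.univ.image w := by
    apply Finset.coe_injective; simp [hR]
  have h1 := Finset.sum_powerset_apply_card (fun i => (-1 : ℝ) ^ (N - i) *
      (volume.real W ^ i / (n.descFactorial i : ℝ)) *
      (volume.real W ^ (N - i) / (m.descFactorial (N - i) : ℝ)) *
        tupleSum Φ i (Finset.univ.image u) (Finset.univ.image w))
      (x := (Finset.univ : Finset (Fin N)))
  simp only [Finset.powerset_univ, Finset.card_univ, Fintype.card_fin, nsmul_eq_mul] at h1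
  rw [edgeEstimator]
  simp only [mul_assoc] at h1 ⊢
  rw [← h1, Fintype.sum_prod_type, Finset.mul_sum, Finset.mul_sum]
  refine Finset.sum_congr rfl fun A _ => ?_
  have h2 := sum_joinPts_div hn hm h u w A
  rw [← tupleSum_image Φ _ hu hw] at h2
  have hA : A.card ≤ N := by simpa using A.card_le_univ
  have hsign : (-1 : ℝ) ^ (N - A.card) = (-1) ^ N * (-1) ^ A.card := by
    have : N + A.card = (N - A.card) + 2 * A.card := by omega
    rw [← pow_add, this, pow_add, pow_mul]; simp
  have hpow : volume.real W ^ N = volume.real W ^ A.card * volume.real W ^ (N - A.card) := by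
    rw [← pow_add]; congr 1; omega
  dsimp only
  rw [hsign, ← Finset.mul_sum, Fintype.sum_prod_type]
  simp only [Function.comp_def] at h2
  calc _ = 1 / phaseTotal W Φ * ((-1) ^ N * (-1) ^ A.card * (volume.real W ^ A.card *
        volume.real W ^ (N - A.card)) * (tupleSum Φ A.card (Finset.univ.image u)
          (Finset.univ.image w) / n.descFactorial A.card / m.descFactorial (N - A.card))) := by
        ring
    _ = _ := by rw [h2, ← hpow]; ring

/-! ### The limit of the signed double sum -/

theorem sum_comm_pairs {α β γ δ : Type*} [Fintype α] [Fintype β] [Fintype γ] [Fintype δ]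
    (F : α → β → γ → δ → ℝ) :
    ∑ x, ∑ y, ∑ z, ∑ w, F x y z w = ∑ z, ∑ w, ∑ x, ∑ y, F x y z w := by
  calc _ = ∑ p : α × β, ∑ q : γ × δ, F p.1 p.2 q.1 q.2 := by simp only [Fintype.sum_prod_type]
    _ = ∑ q : γ × δ, ∑ p : α × β, F p.1 p.2 q.1 q.2 := Finset.sum_comm
    _ = _ := by simp only [Fintype.sum_prod_type]

theorem tendsto_sum_mixedIndex_overlap {N n : ℕ} (hn : N ≤ n) (K : ℕ → ℝ) :
    Tendsto (fun m : ℕ => (∑ t : Finset (Fin N) × (Fin N ↪ Fin n) × (Fin N ↪ Fin m),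
      ∑ t' : Finset (Fin N) × (Fin N ↪ Fin n) × (Fin N ↪ Fin m),
        (-1) ^ t.1.card * (-1) ^ t'.1.card *
          K (Finset.univ.map (mixedIndex t.1 t.2.1 t.2.2) ∩
            Finset.univ.map (mixedIndex t'.1 t'.2.1 t'.2.2)).card) /
        ((n.descFactorial N : ℝ) ^ 2 * (m.descFactorial N : ℝ) ^ 2)) atTop
      (𝓝 ((n.choose N : ℝ)⁻¹ *
        ∑ i ∈ Finset.range (N + 1), K i * N.choose i * (-1) ^ (N - i))) := by
  -- The average over pairs of random injections is placed innermost: the outer sums do not depend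
  -- on `m`, so the limit passes through them.
  have hlim : Tendsto (fun m : ℕ => (∑ A : Finset (Fin N), ∑ B : Finset (Fin N),
      ∑ f : Fin N ↪ Fin n, ∑ f' : Fin N ↪ Fin n, (-1) ^ A.card * (-1) ^ B.card *
        ((∑ p : (Fin N ↪ Fin m) × (Fin N ↪ Fin m),
          K ((A.map f ∩ B.map f').card + (Aᶜ.map p.1 ∩ Bᶜ.map p.2).card)) /
          (m.descFactorial N : ℝ) ^ 2)) / (n.descFactorial N : ℝ) ^ 2) atTop
      (𝓝 ((∑ A : Finset (Fin N), ∑ B : Finset (Fin N),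
        ∑ f : Fin N ↪ Fin n, ∑ f' : Fin N ↪ Fin n, (-1) ^ A.card * (-1) ^ B.card *
          K ((A.map f ∩ B.map f').card + 0)) / (n.descFactorial N : ℝ) ^ 2)) := by
    refine Tendsto.div_const (tendsto_finsetSum _ fun A _ => tendsto_finsetSum _ fun B _ =>
      tendsto_finsetSum _ fun f _ => tendsto_finsetSum _ fun f' _ => Tendsto.const_mul _ ?_) _
    exact tendsto_average_overlap (fun j => K ((A.map f ∩ B.map f').card + j)) Aᶜ Bᶜ
  have hval : (∑ A : Finset (Fin N), ∑ B : Finset (Fin N),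
        ∑ f : Fin N ↪ Fin n, ∑ f' : Fin N ↪ Fin n, (-1) ^ A.card * (-1) ^ B.card *
          K ((A.map f ∩ B.map f').card + 0)) / (n.descFactorial N : ℝ) ^ 2 =
      (n.choose N : ℝ)⁻¹ * ∑ i ∈ Finset.range (N + 1), K i * N.choose i * (-1) ^ (N - i) := by
    have e1 : ∑ A : Finset (Fin N), ∑ B : Finset (Fin N),
        ∑ f : Fin N ↪ Fin n, ∑ f' : Fin N ↪ Fin n, (-1) ^ A.card * (-1) ^ B.card *
          K ((A.map f ∩ B.map f').card + 0) =
        ∑ f : Fin N ↪ Fin n, ∑ f' : Fin N ↪ Fin n, ∑ A : Finset (Fin N), ∑ B : Finset (Fin N),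
          (-1) ^ A.card * ((-1) ^ B.card * K (A.map f ∩ B.map f').card) := by
      rw [sum_comm_pairs]
      simp only [add_zero, mul_assoc]
    have e2 : ∑ i ∈ Finset.range (N + 1), K i * N.choose i * (-1) ^ (N - i) =
        (-1) ^ N * ∑ i ∈ Finset.range (N + 1), N.choose i * (-1) ^ i * K i := by
      rw [Finset.mul_sum]
      refine Finset.sum_congr rfl fun i hi => ?_
      have : (-1 : ℝ) ^ (N - i) = (-1) ^ N * (-1) ^ i := by
        have h1 : N + i = (N - i) + 2 * i := by have := Finset.mem_range.1 hi; omega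
        rw [← pow_add, h1, pow_add, pow_mul]; simp
      rw [this]; ring
    have hd : (n.descFactorial N : ℝ) ≠ 0 := by
      rw [Nat.cast_ne_zero, Ne, Nat.descFactorial_eq_zero_iff_lt]; omega
    have hc : (n.descFactorial N : ℝ) = N.factorial * n.choose N := by
      exact_mod_cast Nat.descFactorial_eq_factorial_mul_choose n N
    -- There are `(n)_N` choices of `f` and `N!` of `f'` with the same range; dividing by `(n)_N^2`
    -- leaves `N! / (n)_N`, the inverse binomial coefficient.
    rw [e1, e2]
    simp only [sum_neg_one_pow_card_inter, ← Finset.sum_filter, Finset.sum_const,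
      card_filter_map_univ_eq, Fintype.card_fin, Finset.card_univ, Fintype.card_embedding_eq,
      nsmul_eq_mul]
    rw [hc] at hd ⊢
    have h3 := mul_ne_zero_iff.1 hd
    have h4 := h3.1
    have h5 := h3.2
    field_simp
  rw [hval] at hlim
  refine hlim.congr fun m => ?_
  simp only [card_inter_map_mixedIndex]
  rw [mul_comm, ← div_div]
  congr 1
  simp only [Fintype.sum_prod_type, Finset.sum_div, mul_div_assoc, Finset.mul_sum]
  refine Finset.sum_congr rfl fun A _ => ?_
  rw [Finset.sum_comm]
  refine Finset.sum_congr rfl fun f _ => ?_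
  symm
  rw [Finset.sum_comm]
  refine Finset.sum_congr rfl fun B _ => ?_
  rw [Finset.sum_comm]

/-- `1 ≤ N` supplies the position to toggle; for `N = 0` the sum is `1`. -/
theorem sum_mixedIndex_sign_eq_zero {N n m : ℕ} (hN : 1 ≤ N) :
    ∑ t : Finset (Fin N) × (Fin N ↪ Fin n) × (Fin N ↪ Fin m), (-1 : ℝ) ^ t.1.card = 0 := by
  rw [Fintype.sum_prod_type]
  simp only [Finset.sum_const]
  rw [← Finset.smul_sum]
  have := sum_neg_one_pow_card_mul_eq_zero (fun _ => (1 : ℝ)) (⟨0, hN⟩ : Fin N) fun _ _ => rfl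
  simp only [mul_one] at this
  rw [this, smul_zero]

/-! ### Moments of the estimator and the limiting covariance -/

theorem covariance_eq_integral_mul_of_integral_eq_zero {Ω : Type*} [MeasurableSpace Ω]
    {P : Measure Ω} {f g : Ω → ℝ} (hf : ∫ ω, f ω ∂P = 0) (hg : ∫ ω, g ω ∂P = 0) :
    covariance f g P = ∫ ω, f ω * g ω ∂P := by
  simp [covariance, hf, hg]

theorem AreBinomialProcesses.uniform {Ω : Type*} [MeasurableSpace Ω] {d n m : ℕ}
    {P : Measure Ω} {W : Set (EuclideanSpace ℝ (Fin d))}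
    {X : Fin n → Ω → EuclideanSpace ℝ (Fin d)} {Y : Fin m → Ω → EuclideanSpace ℝ (Fin d)}
    (h : AreBinomialProcesses P W X Y) (i : Fin n ⊕ Fin m) :
    pdf.IsUniform (Sum.elim X Y i) W P volume := by
  cases i
  exacts [h.uniform_left _, h.uniform_right _]

theorem coe_catalog {Ω E ι : Type*} [Fintype ι] (X : ι → Ω → E) (ω : Ω) :
    (catalog X ω : Set E) = Set.range fun i => X i ω := by
  simp [catalog]

theorem sum_elim_apply_point {Ω E κ κ' : Type*} (X : κ → Ω → E) (Y : κ' → Ω → E) (ω : Ω)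
    (s : κ ⊕ κ') : Sum.elim (fun i => X i ω) (fun i => Y i ω) s = Sum.elim X Y s ω := by
  cases s <;> rfl

theorem AreBinomialProcesses.ae_injective {Ω : Type*} [MeasurableSpace Ω] {d n m : ℕ}
    (hd : 1 ≤ d) {P : Measure Ω} [IsProbabilityMeasure P] {W : Set (EuclideanSpace ℝ (Fin d))}
    (hW0 : volume W ≠ 0) (hWtop : volume W ≠ ⊤)
    {X : Fin n → Ω → EuclideanSpace ℝ (Fin d)} {Y : Fin m → Ω → EuclideanSpace ℝ (Fin d)}
    (h : AreBinomialProcesses P W X Y) :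
    ∀ᵐ ω ∂P, (Function.Injective fun i => X i ω) ∧ Function.Injective fun j => Y j ω := by
  filter_upwards [ae_injective_of_uniform hd hW0 hWtop h.indep h.uniform] with ω hω
  exact ⟨fun i j hij => Sum.inl_injective (hω hij), fun i j hij => Sum.inr_injective (hω hij)⟩

theorem integrable_edgeEstimator {d N n m : ℕ} (hd : 1 ≤ d)
    {W : Set (EuclideanSpace ℝ (Fin d))} (hW0 : volume W ≠ 0) (hWtop : volume W ≠ ⊤)
    {Φ : (Fin N → EuclideanSpace ℝ (Fin d)) → ℝ} (hi : Integrable Φ (domMeasure W N))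
    {Ω : Type*} [MeasurableSpace Ω] {P : Measure Ω} [IsProbabilityMeasure P]
    {X : Fin n → Ω → EuclideanSpace ℝ (Fin d)} {Y : Fin m → Ω → EuclideanSpace ℝ (Fin d)}
    (hXY : AreBinomialProcesses P W X Y) :
    Integrable (fun ω => edgeEstimator W Φ n m (catalog X ω) (catalog Y ω)) P := by
  obtain ⟨T, _, c, p, hT⟩ := exists_edgeEstimator_eq_linear (N := N) W n m
  refine ((integrable_linear_comp_and_integral_eq hW0 hWtop hXY.indep hXY.uniform hi c
    p).1.const_mul (1 / phaseTotal W Φ)).congr ?_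
  filter_upwards [hXY.ae_injective hd hW0 hWtop] with ω hω
  rw [hT Φ _ _ hω.1 hω.2 _ _ (coe_catalog X ω) (coe_catalog Y ω)]
  simp only [sum_elim_apply_point]

theorem integrable_edgeEstimator_mul {d N n m : ℕ} (hd : 1 ≤ d)
    {W : Set (EuclideanSpace ℝ (Fin d))} (hW0 : volume W ≠ 0) (hWtop : volume W ≠ ⊤)
    {Φa Φb : (Fin N → EuclideanSpace ℝ (Fin d)) → ℝ} (hsa : IsSymmFun Φa) (hsb : IsSymmFun Φb)
    (hS : ∀ k ≤ N, Integrable (sharedProduct Φa Φb k) (sharedMeasure W N k))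
    {Ω : Type*} [MeasurableSpace Ω] {P : Measure Ω} [IsProbabilityMeasure P]
    {X : Fin n → Ω → EuclideanSpace ℝ (Fin d)} {Y : Fin m → Ω → EuclideanSpace ℝ (Fin d)}
    (hXY : AreBinomialProcesses P W X Y) :
    Integrable (fun ω => edgeEstimator W Φa n m (catalog X ω) (catalog Y ω) *
      edgeEstimator W Φb n m (catalog X ω) (catalog Y ω)) P := by
  obtain ⟨T, _, c, p, hT⟩ := exists_edgeEstimator_eq_linear (N := N) W n m
  refine ((integrable_linear_mul_comp_and_integral_eq hW0 hWtop hXY.indep hXY.uniform hsa hsb hS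
    c p).1.const_mul (1 / phaseTotal W Φa * (1 / phaseTotal W Φb))).congr ?_
  filter_upwards [hXY.ae_injective hd hW0 hWtop] with ω hω
  rw [hT Φa _ _ hω.1 hω.2 _ _ (coe_catalog X ω) (coe_catalog Y ω),
    hT Φb _ _ hω.1 hω.2 _ _ (coe_catalog X ω) (coe_catalog Y ω)]
  simp only [sum_elim_apply_point]
  ring

theorem integral_edgeEstimator_eq_zero {d N n m : ℕ} (hd : 1 ≤ d) (hN : 1 ≤ N) (hn : N ≤ n)
    (hm : N ≤ m)
    {W : Set (EuclideanSpace ℝ (Fin d))} (hW0 : volume W ≠ 0) (hWtop : volume W ≠ ⊤)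
    {Φ : (Fin N → EuclideanSpace ℝ (Fin d)) → ℝ} (hs : IsSymmFun Φ)
    (hi : Integrable Φ (domMeasure W N))
    {Ω : Type*} [MeasurableSpace Ω] {P : Measure Ω} [IsProbabilityMeasure P]
    {X : Fin n → Ω → EuclideanSpace ℝ (Fin d)} {Y : Fin m → Ω → EuclideanSpace ℝ (Fin d)}
    (hXY : AreBinomialProcesses P W X Y) :
    ∫ ω, edgeEstimator W Φ n m (catalog X ω) (catalog Y ω) ∂P = 0 := by
  have h := (integrable_linear_comp_and_integral_eq hW0 hWtop hXY.indep hXY.uniform hi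
    (fun t : Finset (Fin N) × (Fin N ↪ Fin n) × (Fin N ↪ Fin m) => (-1 : ℝ) ^ t.1.card)
    (fun t => mixedIndex t.1 t.2.1 t.2.2)).2
  rw [sum_mixedIndex_sign_eq_zero hN, zero_mul] at h
  have e : (fun ω => edgeEstimator W Φ n m (catalog X ω) (catalog Y ω)) =ᵐ[P] fun ω =>
      (-1) ^ N * volume.real W ^ N / (phaseTotal W Φ * n.descFactorial N * m.descFactorial N) *
        ∑ t : Finset (Fin N) × (Fin N ↪ Fin n) × (Fin N ↪ Fin m),
          (-1) ^ t.1.card * Φ fun j => Sum.elim X Y (mixedIndex t.1 t.2.1 t.2.2 j) ω := by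
    filter_upwards [hXY.ae_injective hd hW0 hWtop] with ω hω
    rw [edgeEstimator_eq_sum_mixedIndex hn hm W hs hω.1 hω.2 (coe_catalog X ω)
      (coe_catalog Y ω)]
    simp only [sum_elim_apply_point]
  rw [integral_congr_ae e, integral_const_mul, h, mul_zero]

theorem integral_edgeEstimator_mul_eq {d N n m : ℕ} (hd : 1 ≤ d) (hn : N ≤ n) (hm : N ≤ m)
    {W : Set (EuclideanSpace ℝ (Fin d))} (hW0 : volume W ≠ 0) (hWtop : volume W ≠ ⊤)
    {Φa Φb : (Fin N → EuclideanSpace ℝ (Fin d)) → ℝ} (hsa : IsSymmFun Φa) (hsb : IsSymmFun Φb)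
    (hS : ∀ k ≤ N, Integrable (sharedProduct Φa Φb k) (sharedMeasure W N k))
    {Ω : Type*} [MeasurableSpace Ω] {P : Measure Ω} [IsProbabilityMeasure P]
    {X : Fin n → Ω → EuclideanSpace ℝ (Fin d)} {Y : Fin m → Ω → EuclideanSpace ℝ (Fin d)}
    (hXY : AreBinomialProcesses P W X Y) :
    ∫ ω, edgeEstimator W Φa n m (catalog X ω) (catalog Y ω) *
        edgeEstimator W Φb n m (catalog X ω) (catalog Y ω) ∂P =
      1 / (phaseTotal W Φa * phaseTotal W Φb) *
        ((∑ t : Finset (Fin N) × (Fin N ↪ Fin n) × (Fin N ↪ Fin m),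
          ∑ t' : Finset (Fin N) × (Fin N ↪ Fin n) × (Fin N ↪ Fin m),
            (-1) ^ t.1.card * (-1) ^ t'.1.card *
              (fun k => phaseShared W Φa Φb k * volume.real W ^ k)
                (Finset.univ.map (mixedIndex t.1 t.2.1 t.2.2) ∩
                  Finset.univ.map (mixedIndex t'.1 t'.2.1 t'.2.2)).card) /
          ((n.descFactorial N : ℝ) ^ 2 * (m.descFactorial N : ℝ) ^ 2)) := by
  have h := (integrable_linear_mul_comp_and_integral_eq hW0 hWtop hXY.indep hXY.uniform hsa hsb hS
    (fun t : Finset (Fin N) × (Fin N ↪ Fin n) × (Fin N ↪ Fin m) => (-1 : ℝ) ^ t.1.card)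
    (fun t => mixedIndex t.1 t.2.1 t.2.2)).2
  set ca := (-1) ^ N * volume.real W ^ N /
    (phaseTotal W Φa * n.descFactorial N * m.descFactorial N) with hca
  set cb := (-1) ^ N * volume.real W ^ N /
    (phaseTotal W Φb * n.descFactorial N * m.descFactorial N) with hcb
  have e : (fun ω => edgeEstimator W Φa n m (catalog X ω) (catalog Y ω) *
      edgeEstimator W Φb n m (catalog X ω) (catalog Y ω)) =ᵐ[P] fun ω => ca * cb *
        ((∑ t : Finset (Fin N) × (Fin N ↪ Fin n) × (Fin N ↪ Fin m),
          (-1) ^ t.1.card * Φa fun j => Sum.elim X Y (mixedIndex t.1 t.2.1 t.2.2 j) ω) *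
        ∑ t : Finset (Fin N) × (Fin N ↪ Fin n) × (Fin N ↪ Fin m),
          (-1) ^ t.1.card * Φb fun j => Sum.elim X Y (mixedIndex t.1 t.2.1 t.2.2 j) ω) := by
    filter_upwards [hXY.ae_injective hd hW0 hWtop] with ω hω
    rw [edgeEstimator_eq_sum_mixedIndex hn hm W hsa hω.1 hω.2 (coe_catalog X ω)
      (coe_catalog Y ω), edgeEstimator_eq_sum_mixedIndex hn hm W hsb hω.1 hω.2 (coe_catalog X ω)
      (coe_catalog Y ω)]
    simp only [sum_elim_apply_point]
    rw [← hca, ← hcb]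
    ring
  rw [integral_congr_ae e, integral_const_mul, h]
  have hv : volume.real W ≠ 0 := by simp [Measure.real, ENNReal.toReal_eq_zero_iff, hW0, hWtop]
  -- The factor `v^(2N)` from the two prefactors cancels the common denominator of the pair moments,
  -- and the global signs square to one.
  have hcc : ca * cb = 1 / (phaseTotal W Φa * phaseTotal W Φb) *
      (volume.real W ^ (2 * N) /
        ((n.descFactorial N : ℝ) ^ 2 * (m.descFactorial N : ℝ) ^ 2)) := by
    have hsq : ((-1 : ℝ) ^ N) ^ 2 = 1 := by rw [← pow_mul, mul_comm, pow_mul]; simp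
    calc ca * cb = ((-1 : ℝ) ^ N) ^ 2 * (1 / (phaseTotal W Φa * phaseTotal W Φb) *
      (volume.real W ^ (2 * N) /
        ((n.descFactorial N : ℝ) ^ 2 * (m.descFactorial N : ℝ) ^ 2))) := by
          rw [hca, hcb]; ring
      _ = _ := by rw [hsq, one_mul]
  rw [hcc, mul_assoc]
  congr 1
  rw [div_mul_eq_mul_div, Finset.mul_sum]
  congr 1
  refine Finset.sum_congr rfl fun t _ => ?_
  rw [Finset.mul_sum]
  refine Finset.sum_congr rfl fun t' _ => ?_
  field_simp

theorem theorem2 {d N n : ℕ} (hd : 1 ≤ d) (hN : 1 ≤ N) (hn : N ≤ n)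
    (W : Set (EuclideanSpace ℝ (Fin d))) (hW : MeasurableSet W)
    (hW0 : volume W ≠ 0) (hWtop : volume W ≠ ⊤)
    (Φa Φb : (Fin N → EuclideanSpace ℝ (Fin d)) → ℝ)
    (hsa : IsSymmFun Φa) (hsb : IsSymmFun Φb)
    (hia : Integrable Φa (domMeasure W N)) (hib : Integrable Φb (domMeasure W N))
    (hS : ∀ k ≤ N, Integrable (sharedProduct Φa Φb k) (sharedMeasure W N k))
    (hSa : phaseTotal W Φa ≠ 0) (hSb : phaseTotal W Φb ≠ 0)
    {Ω : ℕ → Type*} [∀ m, MeasurableSpace (Ω m)] (P : ∀ m, Measure (Ω m))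
    [∀ m, IsProbabilityMeasure (P m)]
    (X : ∀ m, Fin n → Ω m → EuclideanSpace ℝ (Fin d))
    (Y : ∀ m, Fin m → Ω m → EuclideanSpace ℝ (Fin d))
    (hXY : ∀ m, AreBinomialProcesses (P m) W (X m) (Y m)) :
    (∀ m, Integrable (fun ω => edgeEstimator W Φa n m (catalog (X m) ω) (catalog (Y m) ω)) (P m) ∧
      Integrable (fun ω => edgeEstimator W Φb n m (catalog (X m) ω) (catalog (Y m) ω)) (P m) ∧
      Integrable (fun ω => edgeEstimator W Φa n m (catalog (X m) ω) (catalog (Y m) ω) *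
        edgeEstimator W Φb n m (catalog (X m) ω) (catalog (Y m) ω)) (P m)) ∧
    Tendsto (fun m : ℕ => covariance
        (fun ω => edgeEstimator W Φa n m (catalog (X m) ω) (catalog (Y m) ω))
        (fun ω => edgeEstimator W Φb n m (catalog (X m) ω) (catalog (Y m) ω)) (P m))
      atTop
      (𝓝 (1 / (phaseTotal W Φa * phaseTotal W Φb) * (n.choose N : ℝ)⁻¹ *
        ∑ i ∈ Finset.range (N + 1),
          phaseShared W Φa Φb i * volume.real W ^ i * (N.choose i : ℝ) * (-1) ^ (N - i))) := by
  refine ⟨fun m => ⟨integrable_edgeEstimator hd hW0 hWtop hia (hXY m),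
    integrable_edgeEstimator hd hW0 hWtop hib (hXY m),
    integrable_edgeEstimator_mul hd hW0 hWtop hsa hsb hS (hXY m)⟩, ?_⟩
  have h := (tendsto_sum_mixedIndex_overlap hn
    (fun k => phaseShared W Φa Φb k * volume.real W ^ k)).const_mul
      (1 / (phaseTotal W Φa * phaseTotal W Φb))
  rw [← mul_assoc] at h
  refine h.congr' ?_
  -- The exact first and second moment formulas require `N ≤ m`, which holds eventually.
  filter_upwards [eventually_ge_atTop N] with m hm
  rw [covariance_eq_integral_mul_of_integral_eq_zero
    (integral_edgeEstimator_eq_zero hd hN hn hm hW0 hWtop hsa hia (hXY m))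
    (integral_edgeEstimator_eq_zero hd hN hn hm hW0 hWtop hsb hib (hXY m)),
    integral_edgeEstimator_mul_eq hd hn hm hW0 hWtop hsa hsb hS (hXY m)]
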